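/- Let $P,R,J\ge 1$ be integers, let $I_1,\dots,I_P$ be powers of two, and put $\tilde I=I_1I_2\cdots I_P$. Let $X\in\mathbb R^{\tilde I\times R}$ be a matrix each of whose columns is a Kronecker product $x_r=x_r^{(1)}\otimes\cdots\otimes x_r^{(P)}$ with $x_r^{(p)}\in\mathbb R^{I_p}$. For each $p$ let $H^{(p)}\in\mathbb R^{I_p\times I_p}$ be the normalized (Walsh--)Hadamard matrix, with entries $H^{(p)}_{ij}=I_p^{-1/2}(-1)^{\langle i-1,j-1\rangle}$, where $\langle\cdot,\cdot\rangle$ is the dot product of the binary digit vectors, and let $D^{(p)}\in\mathbb R^{I_p\times I_p}$ be a random diagonal matrix whose diagonal entries are Rademacher variables ($\pm1$ with probability $1/2$ each), all of these variables, over all $p$ and all positions, being mutually independent. Put $$\Phi=\bigotimes_{p=1}^P H^{(p)}D^{(p)}.$$ Let $v_1,\dots,v_J$ be independent and uniformly distributed on $\{1,\dots,\tilde I\}$, independent of $\Phi$, and let $S_q\in\mathbb R^{J\times\tilde I}$ be the sampling matrix whose $j$-th row is $\sqrt{\tilde I/J}\,e_{v_j}^\top$, where $e_i$ is the $i$-th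 standard basis vector. Let $\varepsilon\in(0,1)$ and $\delta>0$. If $$J>\frac83\cdot 2^P R^{P+1}\varepsilon^{-2}\ln\Big(\frac{2R(P+1)}{\delta}\Big)\prod_{p=1}^P\ln\Big(\frac{2I_pR(P+1)}{\delta}\Big),$$ then, with probability at least $1-\delta$, $S_q\Phi$ is a $(1\pm\varepsilon)$ $\ell_2$-subspace embedding for the column space of $X$, that is, $$(1-\varepsilon)\|Xz\|_2^2\le\|S_q\Phi Xz\|_2^2\le(1+\varepsilon)\|Xz\|_2^2\qquad\text{for all } z\in\mathbb R^R.$$ -/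

import Mathlib

open MeasureTheory ProbabilityTheory

noncomputable section

namespace KFJLT

/-- The normalized (Walsh-)Hadamard transform of size `2 ^ k`: with rows and columns numbered from
`0`, the `(i, j)` entry is `(2 ^ k) ^ (-1/2) * (-1) ^ ⟨i, j⟩`, where `⟨i, j⟩` is the dot product of
the binary digit vectors of `i` and `j`. -/
def hadamard (k : ℕ) : Matrix (Fin (2 ^ k)) (Fin (2 ^ k)) ℝ :=
  Matrix.of fun i j =>
    (1 / Real.sqrt ((2 : ℝ) ^ k)) *
      (-1) ^ (∑ b ∈ Finset.range k, ((i : ℕ) / 2 ^ b % 2) * ((j : ℕ) / 2 ^ b % 2))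

/-- The Kronecker product of a finite family of matrices, with rows and columns indexed by
multi-indices. -/
def kron {P : ℕ} {m n : Fin P → Type*} (A : ∀ p, Matrix (m p) (n p) ℝ) :
    Matrix (∀ p, m p) (∀ p, n p) ℝ :=
  Matrix.of fun i j => ∏ p, A p (i p) (j p)

/-- The Kronecker product of a finite family of vectors. -/
def kronVec {P : ℕ} {m : Fin P → Type*} (x : ∀ p, m p → ℝ) : (∀ p, m p) → ℝ :=
  fun i => ∏ p, x p (i p)

/-- The set of all Kronecker vectors. -/
def kronVectors {P : ℕ} (m : Fin P → Type*) : Set ((∀ p, m p) → ℝ) :=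
  Set.range kronVec

/-- A random sign, `1` and `-1` with probability one half each. -/
structure IsRademacher {Ω : Type*} [MeasurableSpace Ω] (ξ : Ω → ℝ) (μ : Measure Ω) : Prop where
  measurable : Measurable ξ
  prob_one : μ {ω | ξ ω = 1} = 1 / 2
  prob_neg_one : μ {ω | ξ ω = -1} = 1 / 2

/-- `v` is a vector of `J` independent random indices, each distributed according to `q`. -/
structure IsSampleVector {Ω ι : Type*} [MeasurableSpace Ω] [MeasurableSpace ι] {J : ℕ}
    (q : ι → ℝ) (v : Fin J → Ω → ι) (μ : Measure Ω) : Prop where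
  measurable : ∀ j, Measurable (v j)
  prob : ∀ j i, μ {ω | v j ω = i} = ENNReal.ofReal (q i)
  indep : iIndepFun v μ

/-- The sampling matrix `S_q`, the product of the diagonal rescaling matrix with entries
`1 / √(J q_{v_j})` and of the row-sampling matrix whose `j`-th row is the `v_j`-th unit vector. -/
def samplingMatrix {ι : Type*} [DecidableEq ι] {J : ℕ} (q : ι → ℝ) (v : Fin J → ι) :
    Matrix (Fin J) ι ℝ :=
  Matrix.diagonal (fun j => 1 / Real.sqrt ((J : ℝ) * q (v j))) *
    Matrix.of (fun j => Pi.single (v j) (1 : ℝ))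

/-- The uniform distribution on a finite index set. -/
def uniformDist (ι : Type*) [Fintype ι] : ι → ℝ := fun _ => 1 / (Fintype.card ι : ℝ)

/-- The Kronecker product of the maps `H D`, with `D` the diagonal matrix of the given signs. -/
def kronHadamard {P : ℕ} (k : Fin P → ℕ) (s : ∀ p, Fin (2 ^ k p) → ℝ) :
    Matrix (∀ p, Fin (2 ^ k p)) (∀ p, Fin (2 ^ k p)) ℝ :=
  kron fun p => hadamard (k p) * Matrix.diagonal (s p)

/-- `M` is a `(1 ± ε)` `ℓ²`-subspace embedding for the column space of `X`. -/
def IsSubspaceEmbedding {ι κ ρ : Type*} [Fintype ι] [Fintype κ] [Fintype ρ] (ε : ℝ)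
    (M : Matrix κ ι ℝ) (X : Matrix ι ρ ℝ) : Prop :=
  ∀ z : ρ → ℝ,
    (1 - ε) * ‖WithLp.toLp 2 (X.mulVec z)‖ ^ 2 ≤ ‖WithLp.toLp 2 (M.mulVec (X.mulVec z))‖ ^ 2 ∧
    ‖WithLp.toLp 2 (M.mulVec (X.mulVec z))‖ ^ 2 ≤ (1 + ε) * ‖WithLp.toLp 2 (X.mulVec z)‖ ^ 2

end KFJLT

end

/-!
For fixed signs the transform `Φ` is orthogonal, and the sampled rows of `Φ` embed the column space
`W` of `X` as soon as an average of `J` independent matrices is close to the identity: if `e` is an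
orthonormal basis of `W` and `u i` is the vector of the `i`-th entries of the `Φ (e a)`, these are the
matrices `N * u uᵀ` for the sampled rows `u`, where `N` is the number of rows. How large `J` has to be
depends on the leverage scores `‖u i‖ ^ 2`.

*Leverage scores.* Restricted to `W`, a row of `Φ` acts like the Kronecker product of the
projections of the rows of the factors `H D` to the spans of the factors of the columns of `X`.
Hence the leverage score is at most the product of the leverage scores of the factors
(`leverage_kron_le`). By Hoeffding's inequality, the images under `H D` of the at most `R` basis
vectors of the `p`-th span have all squared entries below `2 * L p / I p`, up to probability
`δ / (P + 1)`, where `L p` is the logarithm belonging to `p` in the theorem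
(`measure_exists_hadamard_entry_ge_le`). So `N * ‖u i‖ ^ 2 ≤ M` with `M = ∏ p, 2 * R * L p`.

*Sampling.* The number of samples exceeds `8 / 3 * R * M * L₀ / ε ^ 2`, which has a factor `R` more
than the matrix Bernstein inequality needs. This permits working with the Frobenius norm instead of
the operator norm, and so with a Bernstein inequality in an inner product space
(`vector_bernstein`), which rests on Pinelis's argument: when an independent centred vector `Y` is
added to `S`, the expectation of `cosh ‖S‖` grows at most by the factor
`𝔼 (exp ‖Y‖ - ‖Y‖)` (`cosh_norm_add_le`). The Frobenius mean square of `N * u uᵀ - 1` is at most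
`M * R` and its norm at most `M`, and with these the failure probability is at most `δ / (P + 1)`
for each good choice of signs (`card_bad_samples_le`). As the sample is uniform, expectations over it
are sums over all sample vectors.

The `P + 1` failure probabilities add up to `δ`; independence of the signs and the sample is used
to fix the finitely many sign patterns one at a time (`measure_mem_of_indepFun_le`).
-/

namespace KFJLT

/-! ### Concentration of sums in an inner product space -/

/-- The function `u ↦ cosh √u` is convex on `[0, ∞)`, being a power series in `u` with nonnegative
coefficients. -/
lemma cosh_sqrt_convex {a b θ : ℝ} (ha : 0 ≤ a) (hb : 0 ≤ b) (h0 : 0 ≤ θ) (h1 : θ ≤ 1) :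
    Real.cosh √(θ * a + (1 - θ) * b) ≤ θ * Real.cosh √a + (1 - θ) * Real.cosh √b := by
  have key : ∀ u : ℝ, 0 ≤ u → HasSum (fun n : ℕ => u ^ n / (2 * n).factorial) (Real.cosh √u) := by
    intro u hu
    have := Real.hasSum_cosh √u
    simpa only [pow_mul, Real.sq_sqrt hu] using this
  have h1' : 0 ≤ 1 - θ := by linarith
  refine hasSum_le (fun n => ?_) (key _ (by positivity))
    (((key a ha).mul_left θ).add ((key b hb).mul_left (1 - θ)))
  rw [mul_div_assoc', mul_div_assoc', ← add_div]
  gcongr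
  have := (convexOn_pow n).2 (Set.mem_Ici.2 ha) (Set.mem_Ici.2 hb) h0 h1' (by ring)
  simpa using this

/-- The first-order expansion of `cosh ‖x + y‖` at `x`. With the two norms fixed, the left side is
a convex function of `⟪x, y⟫`, and the right side an affine one, so that it suffices to compare
them where `y` is parallel to `x`. -/
lemma cosh_norm_add_le {E : Type*} [NormedAddCommGroup E] [InnerProductSpace ℝ E] (x y : E) :
    Real.cosh ‖x + y‖ ≤ Real.cosh ‖x‖ * (Real.exp ‖y‖ - ‖y‖)
      + Real.sinh ‖x‖ / ‖x‖ * inner ℝ x y := by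
  have ha := norm_nonneg x
  have hb := norm_nonneg y
  have hin := abs_le.1 (abs_real_inner_le_norm x y)
  have hsq := norm_add_sq_real x y
  have hsb : ‖y‖ ≤ Real.sinh ‖y‖ := Real.self_le_sinh_iff.2 hb
  have hsa : 0 ≤ Real.sinh ‖x‖ := Real.sinh_nonneg_iff.2 ha
  have hsc : Real.sinh ‖x‖ ≤ Real.cosh ‖x‖ := (Real.sinh_lt_cosh _).le
  have hexp := Real.cosh_add_sinh ‖y‖
  rcases eq_or_lt_of_le (mul_nonneg ha hb) with h0 | hpos
  · rcases mul_eq_zero.1 h0.symm with h | h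
    · rw [norm_eq_zero.1 h]; simp; linarith
    · rw [norm_eq_zero.1 h]; simp
  · have hx : 0 < ‖x‖ := pos_of_mul_pos_left hpos hb
    have hy : 0 < ‖y‖ := pos_of_mul_pos_right hpos ha
    set a := ‖x‖
    set b := ‖y‖
    set t := inner ℝ x y
    -- the cosine of the angle between the vectors is `2 * θ - 1`
    set θ : ℝ := (1 + t / (a * b)) / 2 with hθ
    have ht : t = a * b * (2 * θ - 1) := by rw [hθ]; field_simp; ring
    have hθ0 : 0 ≤ θ := by
      have : 0 ≤ a * b * (2 * θ) := by linarith
      have := nonneg_of_mul_nonneg_right this hpos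
      linarith
    have hθ1 : θ ≤ 1 := by
      have : 0 ≤ a * b * (2 * (1 - θ)) := by linarith
      have := nonneg_of_mul_nonneg_right this hpos
      linarith
    have h := cosh_sqrt_convex (sq_nonneg (a + b)) (sq_nonneg (a - b)) hθ0 hθ1
    have e : θ * (a + b) ^ 2 + (1 - θ) * (a - b) ^ 2 = ‖x + y‖ ^ 2 := by
      rw [hsq, ht]; ring
    rw [e, Real.sqrt_sq (norm_nonneg _), Real.sqrt_sq_eq_abs, Real.sqrt_sq_eq_abs, Real.cosh_abs,
      Real.cosh_abs, Real.cosh_add, Real.cosh_sub] at h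
    have e2 : Real.sinh a / a * t = Real.sinh a * b * (2 * θ - 1) := by
      rw [ht]; field_simp
    rw [e2, ← hexp]
    have h3 : 0 ≤ Real.sinh a * (Real.sinh b - b) := mul_nonneg hsa (by linarith)
    have h4 : 0 ≤ (Real.cosh a - Real.sinh a) * (Real.sinh b - b) :=
      mul_nonneg (by linarith) (by linarith)
    have h5 : 0 ≤ (1 - θ) * (Real.sinh a * (Real.sinh b - b)) := mul_nonneg (by linarith) h3
    nlinarith

/-- If `Y` has mean zero under the uniform distribution, the expectation of
`cosh ‖x + ∑ j, Y (v j)‖` over uniform `v` grows by a factor that does not depend on `x` with each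
new summand. -/
lemma sum_cosh_norm_le {ι E : Type*} [Fintype ι] [NormedAddCommGroup E] [InnerProductSpace ℝ E]
    (Y : ι → E) (hY : ∑ i, Y i = 0) (J : ℕ) (x : E) :
    ∑ v : Fin J → ι, Real.cosh ‖x + ∑ j, Y (v j)‖
      ≤ Real.cosh ‖x‖ * (∑ i, (Real.exp ‖Y i‖ - ‖Y i‖)) ^ J := by
  induction J generalizing x with
  | zero => simp
  | succ J ih =>
    have hnn : 0 ≤ ∑ i, (Real.exp ‖Y i‖ - ‖Y i‖) := Finset.sum_nonneg fun i _ => by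
      linarith [Real.add_one_le_exp ‖Y i‖]
    rw [← (Fin.consEquiv fun _ => ι).sum_comp, Fintype.sum_prod_type]
    calc _ = ∑ i, ∑ v : Fin J → ι, Real.cosh ‖(x + Y i) + ∑ j, Y (v j)‖ := by
            refine Finset.sum_congr rfl fun i _ => Finset.sum_congr rfl fun v _ => ?_
            simp [Fin.sum_univ_succ, Fin.consEquiv, add_assoc]
      _ ≤ ∑ i, Real.cosh ‖x + Y i‖ * (∑ i, (Real.exp ‖Y i‖ - ‖Y i‖)) ^ J :=
            Finset.sum_le_sum fun i _ => ih _
      _ = (∑ i, Real.cosh ‖x + Y i‖) * (∑ i, (Real.exp ‖Y i‖ - ‖Y i‖)) ^ J := by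
            rw [Finset.sum_mul]
      _ ≤ (Real.cosh ‖x‖ * ∑ i, (Real.exp ‖Y i‖ - ‖Y i‖))
            * (∑ i, (Real.exp ‖Y i‖ - ‖Y i‖)) ^ J := by
            gcongr
            refine (Finset.sum_le_sum fun i _ => cosh_norm_add_le x (Y i)).trans_eq ?_
            rw [Finset.sum_add_distrib, ← Finset.mul_sum, ← Finset.mul_sum, ← inner_sum, hY]
            simp
      _ = _ := by ring

lemma exp_sub_le_bernstein {x : ℝ} (h0 : 0 ≤ x) (h3 : x < 3) :
    Real.exp x - x ≤ 1 + x ^ 2 / (2 * (1 - x / 3)) := by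
  have hE : HasSum (fun n : ℕ => x ^ n / n.factorial) (Real.exp x) := by
    rw [Real.exp_eq_exp_ℝ]; exact NormedSpace.expSeries_div_hasSum_exp x
  have hE2 := (hasSum_nat_add_iff' 2).2 hE
  have hG := (hasSum_geometric_of_lt_one (r := x / 3) (by positivity) (by linarith)).mul_left
    (x ^ 2 / 2)
  have := hasSum_le (fun n => ?_) hE2 hG
  · simp only [Finset.sum_range_succ, Finset.sum_range_zero] at this
    have e : x ^ 2 / (2 * (1 - x / 3)) = x ^ 2 / 2 * (1 - x / 3)⁻¹ := by
      rw [div_mul_eq_div_div, div_eq_mul_inv]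
    rw [e]
    simp at this
    linarith
  · have hf : (2 * 3 ^ n : ℝ) ≤ (n + 2).factorial := by
      have : ∀ n : ℕ, 2 * 3 ^ n ≤ (n + 2).factorial := by
        intro n
        induction n with
        | zero => simp
        | succ n ih =>
          rw [show n + 1 + 2 = (n + 2) + 1 by ring, Nat.factorial_succ, pow_succ]
          nlinarith
      exact_mod_cast this n
    calc x ^ (n + 2) / ((n + 2).factorial : ℝ) ≤ x ^ (n + 2) / (2 * 3 ^ n) := by gcongr
      _ = x ^ 2 / 2 * (x / 3) ^ n := by rw [div_pow, pow_add]; field_simp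

/-- Bernstein's inequality, with a bound free of the dimension, for the sum of `J` independent
uniform samples from a centred family of vectors of norm at most `B` and mean square norm at most
`V`; probabilities are written as proportions of the set of all sample vectors. -/
lemma vector_bernstein {ι E : Type*} [Fintype ι] [NormedAddCommGroup E]
    [InnerProductSpace ℝ E] (Y : ι → E) (hY : ∑ i, Y i = 0) {B V ε : ℝ} (hB : 0 ≤ B)
    (hV : 0 < V) (hε : 0 < ε) (hYB : ∀ i, ‖Y i‖ ≤ B)
    (hYV : ∑ i, ‖Y i‖ ^ 2 ≤ Fintype.card ι * V) (J : ℕ) [DecidablePred fun v : Fin J → ι =>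
      J * ε < ‖∑ j, Y (v j)‖] :
    ((Finset.univ.filter fun v : Fin J → ι => J * ε < ‖∑ j, Y (v j)‖).card : ℝ)
      ≤ (Fintype.card ι : ℝ) ^ J * (2 * Real.exp (-(J * ε ^ 2 / (2 * (V + B * ε / 3))))) := by
  have hK : 0 < V + B * ε / 3 := by positivity
  -- the minimizer of the exponent that results from the moment bound below
  obtain ⟨l, hl⟩ : ∃ l : ℝ, l = ε / (V + B * ε / 3) := ⟨_, rfl⟩
  have hl0 : 0 < l := by rw [hl]; positivity
  have hlB : 1 - l * B / 3 = V / (V + B * ε / 3) := by rw [hl]; field_simp; ring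
  have hlB0 : 0 < 1 - l * B / 3 := by rw [hlB]; positivity
  set κ : ℝ := l ^ 2 / (2 * (1 - l * B / 3)) with hκ
  have hκ0 : 0 ≤ κ := div_nonneg (sq_nonneg _) (by linarith)
  have hκV : V * κ = l * ε / 2 := by rw [hκ, hlB, hl]; field_simp
  have hY' : ∑ i, l • Y i = 0 := by rw [← Finset.smul_sum, hY, smul_zero]
  have hS := sum_cosh_norm_le (fun i => l • Y i) hY' J 0
  simp only [zero_add, norm_zero, Real.cosh_zero, one_mul, ← Finset.smul_sum, norm_smul,
    Real.norm_of_nonneg hl0.le] at hS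
  have hmom : ∑ i, (Real.exp (l * ‖Y i‖) - l * ‖Y i‖) ≤ Fintype.card ι * Real.exp (V * κ) := by
    calc ∑ i, (Real.exp (l * ‖Y i‖) - l * ‖Y i‖) ≤ ∑ i, (1 + κ * ‖Y i‖ ^ 2) := by
          refine Finset.sum_le_sum fun i _ => ?_
          have hle : l * ‖Y i‖ ≤ l * B := by gcongr; exact hYB i
          refine (exp_sub_le_bernstein (by positivity) (by linarith)).trans ?_
          rw [hκ, div_mul_eq_mul_div, ← mul_pow]
          gcongr
      _ = Fintype.card ι + κ * ∑ i, ‖Y i‖ ^ 2 := by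
          rw [Finset.sum_add_distrib, ← Finset.mul_sum]; simp
      _ ≤ Fintype.card ι + κ * (Fintype.card ι * V) := by gcongr
      _ = Fintype.card ι * (V * κ + 1) := by ring
      _ ≤ _ := by gcongr; exact Real.add_one_le_exp _
  have hmom0 : 0 ≤ ∑ i, (Real.exp (l * ‖Y i‖) - l * ‖Y i‖) := Finset.sum_nonneg fun i _ => by
    linarith [Real.add_one_le_exp (l * ‖Y i‖)]
  have hlow : ((Finset.univ.filter fun v : Fin J → ι => J * ε < ‖∑ j, Y (v j)‖).card : ℝ)
      * (Real.exp (l * (J * ε)) / 2) ≤ ∑ v : Fin J → ι, Real.cosh (l * ‖∑ j, Y (v j)‖) := by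
    rw [← nsmul_eq_mul, ← Finset.sum_const]
    refine (Finset.sum_le_sum fun v hv => ?_).trans (Finset.sum_le_sum_of_subset_of_nonneg
      (Finset.filter_subset _ _) fun v _ _ => (Real.cosh_pos _).le)
    rw [Real.cosh_eq]
    have h1 : Real.exp (l * (J * ε)) ≤ Real.exp (l * ‖∑ j, Y (v j)‖) := by
      gcongr; exact (Finset.mem_filter.1 hv).2.le
    have h2 := Real.exp_pos (-(l * ‖∑ j, Y (v j)‖))
    linarith
  have htot := hlow.trans (hS.trans (pow_le_pow_left₀ hmom0 hmom J))
  rw [mul_pow, ← Real.exp_nat_mul, hκV] at htot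
  have e1 : -(J * ε ^ 2 / (2 * (V + B * ε / 3))) = J * (l * ε / 2) + -(l * (J * ε)) := by
    rw [hl]; field_simp; ring
  rw [e1, Real.exp_add, Real.exp_neg]
  have hp := Real.exp_pos (l * (J * ε))
  calc _ = ((Finset.univ.filter fun v : Fin J → ι => J * ε < ‖∑ j, Y (v j)‖).card : ℝ)
      * (Real.exp (l * (J * ε)) / 2) * (2 * (Real.exp (l * (J * ε)))⁻¹) := by field_simp
    _ ≤ ((Fintype.card ι : ℝ) ^ J * Real.exp (J * (l * ε / 2)))
        * (2 * (Real.exp (l * (J * ε)))⁻¹) := by gcongr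
    _ = _ := by ring

/-! ### Orthonormal columns -/

lemma sum_mulVec_mul_mulVec {ι κ : Type*} [Fintype ι] [Fintype κ] [DecidableEq ι]
    {Φ : Matrix κ ι ℝ} (hΦ : ∀ a b, ∑ i, Φ i a * Φ i b = if a = b then 1 else 0) (x y : ι → ℝ) :
    ∑ i, Φ.mulVec x i * Φ.mulVec y i = ∑ j, x j * y j := by
  simp only [Matrix.mulVec, dotProduct, Finset.sum_mul_sum]
  rw [Finset.sum_comm]
  refine Finset.sum_congr rfl fun a _ => ?_
  rw [Finset.sum_comm]
  have : ∀ b, ∑ i, Φ i a * x a * (Φ i b * y b) = if a = b then x a * y b else 0 := by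
    intro b
    rw [← mul_boole, ← hΦ, Finset.mul_sum]
    exact Finset.sum_congr rfl fun i _ => by ring
  simp [this]

lemma sum_combination_sq {ι α : Type*} [Fintype ι] [Fintype α] [DecidableEq α] {e : α → ι → ℝ}
    (he : ∀ a b, ∑ i, e a i * e b i = if a = b then 1 else 0) (c : α → ℝ) :
    ∑ i, (∑ a, c a • e a) i ^ 2 = ∑ a, c a ^ 2 := by
  have := sum_mulVec_mul_mulVec (Φ := Matrix.of fun i a => e a i) he c c
  simpa [Matrix.mulVec, dotProduct, pow_two, mul_comm] using this

/-! ### Uniform sampling of the rows of a matrix with orthonormal columns -/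

section Sampling
variable {ι α : Type*} [Fintype ι] [DecidableEq α]

/-- The deviation `N u uᵀ - 1` of a rescaled row `u = U i` from its mean over `i`, as a vector of
entries, so that its norm is the Frobenius norm. -/
noncomputable def rowDeviation (U : ι → α → ℝ) (i : ι) : EuclideanSpace ℝ (α × α) :=
  WithLp.toLp 2 fun ab =>
    Fintype.card ι * (U i ab.1 * U i ab.2) - if ab.1 = ab.2 then 1 else 0

lemma sum_rowDeviation {U : ι → α → ℝ}
    (hU : ∀ a b, ∑ i, U i a * U i b = if a = b then 1 else 0) :
    ∑ i, rowDeviation U i = 0 := by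
  ext ab
  simp [rowDeviation, Finset.sum_sub_distrib, ← Finset.mul_sum, hU]

variable [Fintype α]

lemma norm_rowDeviation_sq (U : ι → α → ℝ) (i : ι) :
    ‖rowDeviation U i‖ ^ 2 = (Fintype.card ι * ∑ a, U i a ^ 2) ^ 2
      - 2 * (Fintype.card ι * ∑ a, U i a ^ 2) + Fintype.card α := by
  rw [EuclideanSpace.real_norm_sq_eq, Fintype.sum_prod_type]
  have h : ∀ a b : α, (rowDeviation U i (a, b)) ^ 2
      = (Fintype.card ι : ℝ) ^ 2 * (U i a ^ 2 * U i b ^ 2)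
        + if a = b then 1 - 2 * Fintype.card ι * (U i a * U i b) else 0 := by
    intro a b
    simp only [rowDeviation]
    split_ifs <;> ring
  simp only [h, Finset.sum_add_distrib, Finset.sum_ite_eq, Finset.mem_univ, if_true,
    Finset.sum_sub_distrib, ← Finset.mul_sum, ← Finset.sum_mul]
  simp only [← pow_two, Finset.sum_const, Finset.card_univ, nsmul_eq_mul]
  ring

lemma abs_sum_sq_sub_le (U : ι → α → ℝ) {J : ℕ} (v : Fin J → ι) (c : α → ℝ) :
    |Fintype.card ι * ∑ j, (∑ a, c a * U (v j) a) ^ 2 - J * ∑ a, c a ^ 2|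
      ≤ (∑ a, c a ^ 2) * ‖∑ j, rowDeviation U (v j)‖ := by
  set C : EuclideanSpace ℝ (α × α) := WithLp.toLp 2 fun ab => c ab.1 * c ab.2 with hC
  have hCn : ‖C‖ = ∑ a, c a ^ 2 := by
    rw [← Real.sqrt_sq (norm_nonneg C), EuclideanSpace.real_norm_sq_eq, Fintype.sum_prod_type]
    have : ∑ a, ∑ b, (C (a, b)) ^ 2 = (∑ a, c a ^ 2) ^ 2 := by
      simp only [hC, mul_pow, ← Finset.mul_sum, ← Finset.sum_mul]
      ring
    rw [this, Real.sqrt_sq (Finset.sum_nonneg fun a _ => sq_nonneg _)]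
  have hin : ∀ i, inner ℝ C (rowDeviation U i)
      = Fintype.card ι * (∑ a, c a * U i a) ^ 2 - ∑ a, c a ^ 2 := by
    intro i
    rw [PiLp.inner_apply, Fintype.sum_prod_type]
    have h : ∀ a b : α, inner ℝ (C (a, b)) (rowDeviation U i (a, b))
        = Fintype.card ι * ((c a * U i a) * (c b * U i b))
          - if a = b then c a * c b else 0 := by
      intro a b
      simp only [hC, rowDeviation, RCLike.inner_apply, conj_trivial]
      split_ifs <;> ring
    simp only [h, Finset.sum_sub_distrib, Finset.sum_ite_eq, Finset.mem_univ, if_true,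
      ← Finset.mul_sum, ← Finset.sum_mul, ← pow_two]
  have := abs_real_inner_le_norm C (∑ j, rowDeviation U (v j))
  rw [inner_sum, hCn] at this
  simpa [hin, Finset.sum_sub_distrib, ← Finset.mul_sum] using this

/-- The proportion of the samples of `J` rows for which the rescaled sampled rows fail to embed the
coefficient space within `1 ± ε`. The mean square of the Frobenius norm of a row deviation is at
most `M * R`, where the operator norm would give `M`; this is why the bound contains `M * R`. -/
lemma card_bad_samples_le [Nonempty ι] {U : ι → α → ℝ}
    (hU : ∀ a b, ∑ i, U i a * U i b = if a = b then 1 else 0) {R : ℕ} (hR : 0 < R)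
    (hα : Fintype.card α ≤ R) {M ε : ℝ} (hM0 : 0 < M)
    (hM : ∀ i, Fintype.card ι * ∑ a, U i a ^ 2 ≤ M) (hε : 0 < ε) (J : ℕ)
    [DecidablePred fun v : Fin J → ι => ∃ c : α → ℝ, J * ε * ∑ a, c a ^ 2 <
      |Fintype.card ι * ∑ j, (∑ a, c a * U (v j) a) ^ 2 - J * ∑ a, c a ^ 2|] :
    ((Finset.univ.filter fun v : Fin J → ι => ∃ c : α → ℝ, J * ε * ∑ a, c a ^ 2 <
        |Fintype.card ι * ∑ j, (∑ a, c a * U (v j) a) ^ 2 - J * ∑ a, c a ^ 2|).card : ℝ)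
      ≤ (Fintype.card ι : ℝ) ^ J
        * (2 * Real.exp (-(J * ε ^ 2 / (2 * (M * R + M * ε / 3))))) := by
  classical
  have hN : (0 : ℝ) < Fintype.card ι := by exact_mod_cast Fintype.card_pos
  have htot : ∑ i, (Fintype.card ι * ∑ a, U i a ^ 2 : ℝ) = Fintype.card ι * Fintype.card α := by
    rw [← Finset.mul_sum, Finset.sum_comm]
    simp only [pow_two, hU, if_true, Finset.sum_const, Finset.card_univ, nsmul_eq_mul, mul_one]
  have ht0 : ∀ i, 0 ≤ Fintype.card ι * ∑ a, U i a ^ 2 := fun i =>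
    mul_nonneg hN.le (Finset.sum_nonneg fun a _ => sq_nonneg _)
  -- the squared row norms average to the number of columns, which is thus at most `M`
  have hαM : (Fintype.card α : ℝ) ≤ M := by
    have : (Fintype.card ι : ℝ) * Fintype.card α ≤ Fintype.card ι * M := by
      rw [← htot]
      refine (Finset.sum_le_sum fun i _ => hM i).trans_eq ?_
      simp
    exact le_of_mul_le_mul_left this hN
  have hα0 : (0 : ℝ) ≤ Fintype.card α := Nat.cast_nonneg _
  have hαR : (Fintype.card α : ℝ) ≤ R := by exact_mod_cast hα
  have hR' : (0 : ℝ) < R := by exact_mod_cast hR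
  have hB : ∀ i, ‖rowDeviation U i‖ ≤ M := by
    intro i
    refine abs_le_of_sq_le_sq' ?_ hM0.le |>.2
    rw [norm_rowDeviation_sq]
    rcases Nat.eq_zero_or_pos (Fintype.card α) with h0 | h1
    · have := Fintype.card_eq_zero_iff.1 h0
      simp [sq_nonneg]
    · have h1 : (1 : ℝ) ≤ Fintype.card α := by exact_mod_cast h1
      have := ht0 i
      have := hM i
      nlinarith
  have hV : ∑ i, ‖rowDeviation U i‖ ^ 2 ≤ Fintype.card ι * (M * R) := by
    calc ∑ i, ‖rowDeviation U i‖ ^ 2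
        ≤ ∑ i, ((M - 2) * (Fintype.card ι * ∑ a, U i a ^ 2) + Fintype.card α) := by
          refine Finset.sum_le_sum fun i _ => ?_
          rw [norm_rowDeviation_sq]
          nlinarith [ht0 i, hM i]
      _ = Fintype.card ι * ((M - 1) * Fintype.card α) := by
          rw [Finset.sum_add_distrib, ← Finset.mul_sum, htot]
          simp; ring
      _ ≤ _ := by
          gcongr
          nlinarith
  refine le_trans ?_ (vector_bernstein (rowDeviation U) (sum_rowDeviation hU) hM0.le
    (mul_pos hM0 hR') hε hB hV J)
  norm_cast
  refine Finset.card_le_card fun v hv => ?_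
  simp only [Finset.mem_filter, Finset.mem_univ, true_and] at hv ⊢
  obtain ⟨c, hc⟩ := hv
  have h := hc.trans_le (abs_sum_sq_sub_le U v c)
  rw [mul_comm (∑ a, c a ^ 2)] at h
  exact lt_of_mul_lt_mul_right h (Finset.sum_nonneg fun a _ => sq_nonneg _)

/-- If the columns `e a` are orthonormal and span the column space of `X`, it is enough to compare
the sampled rows of `Φ` on their linear combinations. -/
lemma isSubspaceEmbedding_of_forall [DecidableEq ι] [Nonempty ι] {ρ : Type*} [Fintype ρ] {J : ℕ}
    (hJ : 0 < J)
    {ε : ℝ} (Φ : Matrix ι ι ℝ) (X : Matrix ι ρ ℝ) (v : Fin J → ι) (e : α → ι → ℝ)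
    (he : ∀ a b, ∑ i, e a i * e b i = if a = b then 1 else 0)
    (hspan : ∀ z, ∃ c : α → ℝ, X.mulVec z = ∑ a, c a • e a)
    (hv : ∀ c : α → ℝ, |Fintype.card ι * ∑ j, (∑ a, c a * Φ.mulVec (e a) (v j)) ^ 2
      - J * ∑ a, c a ^ 2| ≤ J * ε * ∑ a, c a ^ 2) :
    IsSubspaceEmbedding ε (samplingMatrix (uniformDist ι) v * Φ) X := by
  intro z
  obtain ⟨c, hc⟩ := hspan z
  have hJ' : (0 : ℝ) < J := by exact_mod_cast hJ
  have hN : (0 : ℝ) < Fintype.card ι := by exact_mod_cast Fintype.card_pos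
  have h1 : ‖WithLp.toLp 2 (X.mulVec z)‖ ^ 2 = ∑ a, c a ^ 2 := by
    rw [EuclideanSpace.real_norm_sq_eq, hc]
    exact sum_combination_sq he c
  have h2 : ‖WithLp.toLp 2 ((samplingMatrix (uniformDist ι) v * Φ).mulVec (X.mulVec z))‖ ^ 2
      = Fintype.card ι / J * ∑ j, (∑ a, c a * Φ.mulVec (e a) (v j)) ^ 2 := by
    rw [EuclideanSpace.real_norm_sq_eq, hc, Finset.mul_sum]
    refine Finset.sum_congr rfl fun j _ => ?_
    rw [← Matrix.mulVec_mulVec, samplingMatrix, ← Matrix.mulVec_mulVec]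
    simp only [Matrix.mulVec_diagonal]
    have h3 : (Matrix.of fun j => Pi.single (v j) (1 : ℝ)).mulVec
        (Φ.mulVec (∑ a, c a • e a)) j = ∑ a, c a * Φ.mulVec (e a) (v j) := by
      simp only [Matrix.mulVec, Matrix.of_apply]
      rw [single_one_dotProduct]
      change Φ.mulVec _ (v j) = ∑ a, c a * Φ.mulVec (e a) (v j)
      simp [Matrix.mulVec_sum, Matrix.mulVec_smul]
    rw [h3, mul_pow, div_pow, Real.sq_sqrt (by unfold uniformDist; positivity)]
    congr 1
    unfold uniformDist
    field_simp
  rw [h1, h2]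
  have h4 := abs_le.1 (hv c)
  constructor
  · rw [div_mul_eq_mul_div, le_div_iff₀ hJ']; linarith [h4.1]
  · rw [div_mul_eq_mul_div, div_le_iff₀ hJ']; linarith [h4.2]

end Sampling

/-! ### The Kronecker product of randomized Hadamard matrices is orthogonal -/

lemma sum_prod_digits (k : ℕ) (f : ℕ → ℕ → ℝ) :
    ∑ i ∈ Finset.range (2 ^ k), ∏ b ∈ Finset.range k, f b (i / 2 ^ b % 2)
      = ∏ b ∈ Finset.range k, (f b 0 + f b 1) := by
  induction k with
  | zero => simp
  | succ k ih =>
    rw [pow_succ, mul_two, Finset.sum_range_add, Finset.prod_range_succ, ← ih, mul_add,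
      Finset.sum_mul, Finset.sum_mul]
    congr 1
    · refine Finset.sum_congr rfl fun i hi => ?_
      rw [Finset.prod_range_succ, Nat.div_eq_of_lt (Finset.mem_range.1 hi)]
    · refine Finset.sum_congr rfl fun i hi => ?_
      rw [Finset.prod_range_succ, Nat.add_div_left _ (by positivity),
        Nat.div_eq_of_lt (Finset.mem_range.1 hi)]
      congr 1
      refine Finset.prod_congr rfl fun b hb => ?_
      congr 1
      obtain ⟨m, hm⟩ := Nat.exists_eq_add_of_lt (Finset.mem_range.1 hb)
      rw [hm, pow_succ, pow_add,
        show 2 ^ b * 2 ^ m * 2 + i = 2 ^ b * (2 ^ m * 2) + i by ring,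
        Nat.mul_add_div (by positivity), Nat.mul_add_mod_self_right]

lemma eq_of_digits_eq {k a b : ℕ} (ha : a < 2 ^ k) (hb : b < 2 ^ k)
    (h : ∀ t < k, a / 2 ^ t % 2 = b / 2 ^ t % 2) : a = b := by
  refine Nat.eq_of_testBit_eq fun t => ?_
  rcases lt_or_ge t k with ht | ht
  · rw [Nat.testBit_eq_decide_div_mod_eq, Nat.testBit_eq_decide_div_mod_eq, h t ht]
  · have h2 := Nat.pow_le_pow_right (n := 2) (by norm_num) ht
    rw [Nat.testBit_lt_two_pow (ha.trans_le h2), Nat.testBit_lt_two_pow (hb.trans_le h2)]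

lemma hadamard_sq (k : ℕ) (i j : Fin (2 ^ k)) : hadamard k i j ^ 2 = 1 / 2 ^ k := by
  rw [hadamard, Matrix.of_apply, mul_pow, div_pow, Real.sq_sqrt (by positivity), ← pow_mul,
    mul_comm _ 2, pow_mul]
  simp

/-- The columns of the Hadamard matrix are orthonormal: the inner product of two columns factors
over the binary digits of the row number, and a digit in which the columns differ gives the factor
`1 + (-1) = 0`. -/
lemma hadamard_orthonormal (k : ℕ) (a b : Fin (2 ^ k)) :
    ∑ i, hadamard k i a * hadamard k i b = if a = b then 1 else 0 := by
  split_ifs with hab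
  · subst hab
    simp [← pow_two, hadamard_sq]
  · obtain ⟨t, ht, hne⟩ : ∃ t < k, (a : ℕ) / 2 ^ t % 2 ≠ (b : ℕ) / 2 ^ t % 2 := by
      by_contra! h
      exact hab (Fin.ext (eq_of_digits_eq a.2 b.2 h))
    set f : ℕ → ℕ → ℝ := fun t d =>
      (-1) ^ (d * ((a : ℕ) / 2 ^ t % 2)) * (-1) ^ (d * ((b : ℕ) / 2 ^ t % 2)) with hf
    have h1 : ∀ i : Fin (2 ^ k), hadamard k i a * hadamard k i b = (1 / √((2 : ℝ) ^ k)) ^ 2 *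
        ∏ t ∈ Finset.range k, f t ((i : ℕ) / 2 ^ t % 2) := by
      intro i
      simp only [hadamard, Matrix.of_apply, hf, Finset.prod_mul_distrib,
        Finset.prod_pow_eq_pow_sum]
      ring
    simp only [h1, ← Finset.mul_sum]
    rw [Fin.sum_univ_eq_sum_range (fun i => ∏ t ∈ Finset.range k, f t (i / 2 ^ t % 2)),
      sum_prod_digits, Finset.prod_eq_zero (Finset.mem_range.2 ht), mul_zero]
    simp only [hf]
    rcases Nat.mod_two_eq_zero_or_one ((a : ℕ) / 2 ^ t) with h | h <;>
    rcases Nat.mod_two_eq_zero_or_one ((b : ℕ) / 2 ^ t) with h' | h' <;>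
    simp_all

lemma sum_prod_apply {P : ℕ} {m : Fin P → Type*} [∀ p, Fintype (m p)] (f : ∀ p, m p → ℝ) :
    ∑ i : ∀ p, m p, ∏ p, f p (i p) = ∏ p, ∑ j, f p j := by
  classical
  rw [Finset.prod_univ_sum, Fintype.piFinset_univ]

lemma kron_mulVec_kronVec {P : ℕ} {m n : Fin P → Type*} [∀ p, Fintype (n p)]
    (A : ∀ p, Matrix (m p) (n p) ℝ) (x : ∀ p, n p → ℝ) (i : ∀ p, m p) :
    (kron A).mulVec (kronVec x) i = ∏ p, (A p).mulVec (x p) (i p) := by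
  simp only [Matrix.mulVec, dotProduct, kron, Matrix.of_apply, kronVec, ← Finset.prod_mul_distrib]
  exact sum_prod_apply fun p j => A p (i p) j * x p j

lemma kron_orthonormal {P : ℕ} {m n : Fin P → Type*} [∀ p, Fintype (m p)] [∀ p, DecidableEq (n p)]
    (A : ∀ p, Matrix (m p) (n p) ℝ)
    (hA : ∀ p a b, ∑ i, A p i a * A p i b = if a = b then 1 else 0) (a b : ∀ p, n p) :
    ∑ i, kron A i a * kron A i b = if a = b then 1 else 0 := by
  simp only [kron, Matrix.of_apply, ← Finset.prod_mul_distrib]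
  rw [sum_prod_apply fun p j => A p j (a p) * A p j (b p)]
  simp only [hA, Finset.prod_ite_zero, Finset.mem_univ, forall_true_left, Finset.prod_const_one,
    funext_iff]

lemma kronHadamard_orthonormal {P : ℕ} (k : Fin P → ℕ) {s : ∀ p, Fin (2 ^ k p) → ℝ}
    (hs : ∀ p j, s p j ^ 2 = 1) (a b : ∀ p, Fin (2 ^ k p)) :
    ∑ i, kronHadamard k s i a * kronHadamard k s i b = if a = b then 1 else 0 := by
  refine kron_orthonormal _ (fun p a b => ?_) a b
  simp only [Matrix.mul_diagonal]
  calc _ = (∑ i, hadamard (k p) i a * hadamard (k p) i b) * (s p a * s p b) := by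
        rw [Finset.sum_mul]; exact Finset.sum_congr rfl fun i _ => by ring
    _ = _ := by
        rw [hadamard_orthonormal]
        split_ifs with h
        · rw [h, ← pow_two, hs, one_mul]
        · simp

/-! ### Coherence of a family of Kronecker vectors -/

/-- Coordinates for the span of `R` vectors: an orthonormal basis of it has at most `R` members. -/
lemma exists_orthonormal_coords {ι : Type*} [Fintype ι] {R : ℕ} (y : Fin R → ι → ℝ) :
    ∃ d ≤ R, ∃ b : Fin d → ι → ℝ,
      (∀ a a', ∑ i, b a i * b a' i = if a = a' then 1 else 0) ∧
      (∀ a, ∃ c : Fin R → ℝ, b a = ∑ r, c r • y r) ∧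
      ∀ z : Fin R → ℝ, ∑ r, z r • y r
        = ∑ a, (∑ i, b a i * (∑ r, z r • y r) i) • b a := by
  let y' : Fin R → EuclideanSpace ℝ ι := fun r => WithLp.toLp 2 (y r)
  let W : Submodule ℝ (EuclideanSpace ℝ ι) := Submodule.span ℝ (Set.range y')
  let B := stdOrthonormalBasis ℝ W
  have hin : ∀ u w : EuclideanSpace ℝ ι, inner ℝ u w = ∑ i, u i * w i := fun u w => by
    rw [PiLp.inner_apply]
    simp [mul_comm]
  refine ⟨Module.finrank ℝ W, (finrank_range_le_card y').trans_eq (Fintype.card_fin R),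
    fun a => (B a : EuclideanSpace ℝ ι).ofLp, fun a a' => ?_, fun a => ?_, fun z => ?_⟩
  · rw [← hin, ← Submodule.coe_inner]
    exact orthonormal_iff_ite.1 B.orthonormal a a'
  · obtain ⟨c, hc⟩ := (Submodule.mem_span_range_iff_exists_fun ℝ).1 (B a).2
    refine ⟨c, ?_⟩
    dsimp only
    rw [← hc]
    ext i
    simp [y']
  · let w : W := ⟨∑ r, z r • y' r, Submodule.sum_mem _ fun r _ =>
      Submodule.smul_mem _ _ (Submodule.subset_span ⟨r, rfl⟩)⟩
    have hw : (w : EuclideanSpace ℝ ι).ofLp = ∑ r, z r • y r := by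
      simp [w, y']
    have h := congrArg (fun u : W => (u : EuclideanSpace ℝ ι).ofLp) (B.sum_repr' w)
    simp only [Submodule.coe_inner, hin, hw] at h
    conv_lhs => rw [← h]
    simp

/-- A row `i` of a Kronecker product of matrices acts on the span of Kronecker vectors as the
Kronecker product of any vectors `g p` acting on the `p`-th factors like the row `i p` of the
`p`-th matrix. -/
lemma sq_kron_mulVec_le {P R : ℕ} {m n : Fin P → Type*} [∀ p, Fintype (n p)]
    (A : ∀ p, Matrix (m p) (n p) ℝ) (i : ∀ p, m p) (x : Fin R → ∀ p, n p → ℝ)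
    (g : ∀ p, n p → ℝ) (hg : ∀ r p, ∑ j, g p j * x r p j = (A p).mulVec (x r p) (i p))
    (c : Fin R → ℝ) :
    ((kron A).mulVec (∑ r, c r • kronVec (x r)) i) ^ 2
      ≤ (∏ p, ∑ j, g p j ^ 2) * ∑ l, (∑ r, c r • kronVec (x r)) l ^ 2 := by
  have h1 : (kron A).mulVec (∑ r, c r • kronVec (x r)) i
      = ∑ l, kronVec g l * (∑ r, c r • kronVec (x r)) l := by
    rw [Matrix.mulVec_sum, Finset.sum_apply]
    simp only [Finset.sum_apply, Pi.smul_apply, Finset.mul_sum, Matrix.mulVec_smul]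
    rw [Finset.sum_comm]
    refine Finset.sum_congr rfl fun r _ => ?_
    rw [kron_mulVec_kronVec]
    simp only [← hg, ← sum_prod_apply fun p j => g p j * x r p j, smul_eq_mul, Finset.mul_sum]
    refine Finset.sum_congr rfl fun l _ => ?_
    rw [Finset.prod_mul_distrib, kronVec, kronVec]
    ring
  have h2 : ∏ p, ∑ j, g p j ^ 2 = ∑ l, kronVec g l ^ 2 := by
    rw [← sum_prod_apply fun p j => g p j ^ 2]
    simp [kronVec, Finset.prod_pow]
  rw [h1, h2]
  exact Finset.sum_mul_sq_le_sq_mul_sq _ _ _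

/-- The leverage scores of a Kronecker product bound those of the span of Kronecker vectors: the
columns of `b p` are orthonormal and span the `p`-th factors, those of `e` are an orthonormal family
of combinations of the Kronecker vectors themselves. -/
lemma leverage_kron_le {P R : ℕ} {m n : Fin P → Type*} [∀ p, Fintype (n p)]
    (A : ∀ p, Matrix (m p) (n p) ℝ) (i : ∀ p, m p) (x : Fin R → ∀ p, n p → ℝ)
    {d : Fin P → ℕ} (b : ∀ p, Fin (d p) → n p → ℝ)
    (hb : ∀ p a a', ∑ j, b p a j * b p a' j = if a = a' then 1 else 0)
    (hbx : ∀ r p, x r p = ∑ a, (∑ j, b p a j * x r p j) • b p a)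
    {D : ℕ} (e : Fin D → (∀ p, n p) → ℝ)
    (he : ∀ a a', ∑ j, e a j * e a' j = if a = a' then 1 else 0)
    (hex : ∀ a, ∃ c : Fin R → ℝ, e a = ∑ r, c r • kronVec (x r)) :
    ∑ a, ((kron A).mulVec (e a) i) ^ 2 ≤ ∏ p, ∑ a, ((A p).mulVec (b p a) (i p)) ^ 2 := by
  -- the projection of the row `i p` to the span of the columns of `b p`
  set g : ∀ p, n p → ℝ := fun p => ∑ a, (A p).mulVec (b p a) (i p) • b p a with hg
  have hgx : ∀ r p, ∑ j, g p j * x r p j = (A p).mulVec (x r p) (i p) := by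
    intro r p
    conv_rhs => rw [hbx r p]
    simp only [hg, Matrix.mulVec_sum, Finset.sum_apply, Matrix.mulVec_smul, Pi.smul_apply,
      smul_eq_mul, Finset.sum_mul]
    rw [Finset.sum_comm]
    refine Finset.sum_congr rfl fun a _ => Finset.sum_congr rfl fun j _ => by ring
  choose c hc using hex
  set S := ∑ a, ((kron A).mulVec (e a) i) ^ 2 with hS
  have hS0 : 0 ≤ S := Finset.sum_nonneg fun a _ => sq_nonneg _
  -- on the span of `e`, the functional given by the row `i` attains its norm at the projection of
  -- that row, whose squared norm is `S`; this gives `S ^ 2 ≤ (∏ ..) * S`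
  have key := sq_kron_mulVec_le A i x g hgx fun r => ∑ a, (kron A).mulVec (e a) i * c a r
  have hz : ∑ r, (∑ a, (kron A).mulVec (e a) i * c a r) • kronVec (x r)
      = ∑ a, (kron A).mulVec (e a) i • e a := by
    conv_rhs => enter [2, a]; rw [hc a, Finset.smul_sum]
    rw [Finset.sum_comm]
    refine Finset.sum_congr rfl fun r _ => ?_
    rw [Finset.sum_smul]
    refine Finset.sum_congr rfl fun a _ => ?_
    rw [smul_smul, ← hc a]
  simp only [hz, sum_combination_sq he, hg, sum_combination_sq (hb _), Matrix.mulVec_sum] at key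
  simp only [Finset.sum_apply, Matrix.mulVec_smul, Pi.smul_apply, smul_eq_mul, ← pow_two, ← hS] at key
  have hprod : 0 ≤ ∏ p, ∑ a, ((A p).mulVec (b p a) (i p)) ^ 2 :=
    Finset.prod_nonneg fun p _ => Finset.sum_nonneg fun a _ => sq_nonneg _
  nlinarith

/-! ### Tail bounds for random signs -/

section Signs
variable {Ω : Type*} [MeasurableSpace Ω] {μ : Measure Ω} [IsProbabilityMeasure μ]

lemma IsRademacher.ae_eq_or {ξ : Ω → ℝ} (h : IsRademacher ξ μ) :
    ∀ᵐ ω ∂μ, ξ ω = 1 ∨ ξ ω = -1 := by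
  have h1 : MeasurableSet {ω | ξ ω = 1} := h.measurable (measurableSet_singleton 1)
  have h2 : MeasurableSet {ω | ξ ω = -1} := h.measurable (measurableSet_singleton (-1))
  have hd : Disjoint {ω | ξ ω = 1} {ω | ξ ω = -1} := by
    rw [Set.disjoint_left]
    intro ω h h'
    simp only [Set.mem_ofPred_eq] at h h'
    linarith
  have hu : μ ({ω | ξ ω = 1} ∪ {ω | ξ ω = -1}) = 1 := by
    rw [measure_union hd h2, h.prob_one, h.prob_neg_one, ENNReal.add_halves]
  exact (mem_ae_iff_prob_eq_one (h1.union h2)).2 hu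

lemma IsRademacher.integral_eq_zero {ξ : Ω → ℝ} (h : IsRademacher ξ μ) : ∫ ω, ξ ω ∂μ = 0 := by
  have h1 : MeasurableSet {ω | ξ ω = 1} := h.measurable (measurableSet_singleton 1)
  have h2 : MeasurableSet {ω | ξ ω = -1} := h.measurable (measurableSet_singleton (-1))
  have e : ξ =ᵐ[μ] fun ω => Set.indicator {ω | ξ ω = 1} (fun _ => (1 : ℝ)) ω
      - Set.indicator {ω | ξ ω = -1} (fun _ => (1 : ℝ)) ω := by
    filter_upwards [h.ae_eq_or] with ω hω
    rcases hω with hω | hω <;> simp [Set.indicator, hω] <;> norm_num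
  rw [integral_congr_ae e, integral_sub ((integrable_const _).indicator h1)
    ((integrable_const _).indicator h2), integral_indicator_const _ h1,
    integral_indicator_const _ h2, Measure.real, Measure.real, h.prob_one, h.prob_neg_one, sub_self]

lemma IsRademacher.hasSubgaussianMGF_const_mul {ξ : Ω → ℝ} (h : IsRademacher ξ μ) (c : ℝ) :
    HasSubgaussianMGF (fun ω => c * ξ ω) (‖c‖₊ ^ 2) μ := by
  have := hasSubgaussianMGF_of_mem_Icc_of_integral_eq_zero (μ := μ) (X := fun ω => c * ξ ω)
    (a := -|c|) (b := |c|) (h.measurable.const_mul c).aemeasurable ?_ ?_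
  · convert this using 2
    rw [← NNReal.coe_inj]
    simp only [coe_nnnorm, NNReal.coe_div, NNReal.coe_ofNat, Real.norm_eq_abs, sub_neg_eq_add]
    rw [abs_of_nonneg (add_nonneg (abs_nonneg c) (abs_nonneg c))]
    ring
  · filter_upwards [h.ae_eq_or] with ω hω
    rw [Set.mem_Icc, ← abs_le, abs_mul]
    rcases hω with hω | hω <;> simp [hω]
  · rw [integral_const_mul, h.integral_eq_zero, mul_zero]

lemma measure_abs_rademacher_sum_ge_le {κ : Type*} [Fintype κ] {s : κ → Ω → ℝ}
    (hs : ∀ j, IsRademacher (s j) μ) (hs_indep : iIndepFun s μ) (c : κ → ℝ) {t : ℝ} (ht : 0 ≤ t) :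
    μ.real {ω | t ≤ |∑ j, c j * s j ω|} ≤ 2 * Real.exp (-t ^ 2 / (2 * ∑ j, c j ^ 2)) := by
  have one_sided : ∀ c : κ → ℝ,
      μ.real {ω | t ≤ ∑ j, c j * s j ω} ≤ Real.exp (-t ^ 2 / (2 * ∑ j, c j ^ 2)) := by
    intro c
    have hi : iIndepFun (fun j ω => c j * s j ω) μ :=
      hs_indep.comp (fun j x => c j * x) fun j => measurable_const_mul (c j)
    have := HasSubgaussianMGF.measure_sum_ge_le_of_iIndepFun hi (s := Finset.univ)
      (fun j _ => (hs j).hasSubgaussianMGF_const_mul (c j)) ht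
    simpa using this
  have hsub : {ω | t ≤ |∑ j, c j * s j ω|}
      ⊆ {ω | t ≤ ∑ j, c j * s j ω} ∪ {ω | t ≤ ∑ j, (-c j) * s j ω} := by
    intro ω hω
    simpa [le_abs, Finset.sum_neg_distrib] using hω
  refine (measureReal_mono hsub).trans ((measureReal_union_le _ _).trans ?_)
  have h2 := one_sided fun j => -c j
  simp only [neg_sq] at h2
  linarith [one_sided c]

/-- The entries of the image of a unit vector under a randomized Hadamard matrix of size `2 ^ k` are
of order `1 / √(2 ^ k)`. -/
lemma measure_hadamard_entry_ge_le {k : ℕ} {s : Fin (2 ^ k) → Ω → ℝ}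
    (hs : ∀ j, IsRademacher (s j) μ) (hs_indep : iIndepFun s μ) (b : Fin (2 ^ k) → ℝ)
    (hb : ∑ j, b j * b j = 1) (i : Fin (2 ^ k)) {L : ℝ} (hL : 0 ≤ L) :
    μ.real {ω | 2 * L / 2 ^ k
        ≤ ((hadamard k * Matrix.diagonal fun j => s j ω).mulVec b i) ^ 2}
      ≤ 2 * Real.exp (-L) := by
  have hV : ∑ j, (hadamard k i j * b j) ^ 2 = 1 / 2 ^ k := by
    simp only [mul_pow, hadamard_sq, ← Finset.mul_sum]
    simp [pow_two, hb]
  have h := measure_abs_rademacher_sum_ge_le hs hs_indep (fun j => hadamard k i j * b j)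
    (Real.sqrt_nonneg (2 * L / 2 ^ k))
  rw [hV, Real.sq_sqrt (by positivity)] at h
  convert h using 4 with ω
  · rw [Real.sqrt_le_left (abs_nonneg _), sq_abs]
    congr! 2
    simp only [Matrix.mulVec, dotProduct, Matrix.mul_diagonal]
    exact Finset.sum_congr rfl fun j _ => by ring
  · field_simp

/-- A union bound over the entries of the images of the columns of `b`. -/
lemma measure_exists_hadamard_entry_ge_le {k : ℕ} {s : Fin (2 ^ k) → Ω → ℝ}
    (hs : ∀ j, IsRademacher (s j) μ) (hs_indep : iIndepFun s μ) {d : ℕ}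
    (b : Fin d → Fin (2 ^ k) → ℝ) (hb : ∀ a, ∑ j, b a j * b a j = 1) {L : ℝ} (hL : 0 ≤ L) :
    μ.real {ω | ∃ i a, 2 * L / 2 ^ k
        ≤ ((hadamard k * Matrix.diagonal fun j => s j ω).mulVec (b a) i) ^ 2}
      ≤ 2 ^ k * d * (2 * Real.exp (-L)) := by
  simp only [Set.ofPred_exists]
  calc _ ≤ ∑ i : Fin (2 ^ k), ∑ a : Fin d, μ.real {ω | 2 * L / 2 ^ k
        ≤ ((hadamard k * Matrix.diagonal fun j => s j ω).mulVec (b a) i) ^ 2} :=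
        (measureReal_iUnion_fintype_le _).trans
          (Finset.sum_le_sum fun i _ => measureReal_iUnion_fintype_le _)
    _ ≤ ∑ _i : Fin (2 ^ k), ∑ _a : Fin d, 2 * Real.exp (-L) := by
        gcongr with i _ a _
        exact measure_hadamard_entry_ge_le hs hs_indep (b a) (hb a) i hL
    _ = _ := by simp; ring

end Signs

/-! ### Uniform samples -/

section Samples
variable {Ω : Type*} [MeasurableSpace Ω] {μ : Measure Ω}

lemma IsSampleVector.measure_mem_le {ι : Type*} [Fintype ι] [Nonempty ι] [MeasurableSpace ι]
    [MeasurableSingletonClass ι] {J : ℕ}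
    {v : Fin J → Ω → ι} (hv : IsSampleVector (uniformDist ι) v μ) (F : Finset (Fin J → ι)) {η : ℝ}
    (hF : (F.card : ℝ) ≤ (Fintype.card ι : ℝ) ^ J * η) :
    μ {ω | (fun j => v j ω) ∈ F} ≤ ENNReal.ofReal η := by
  have hN : (0 : ℝ) < Fintype.card ι := by exact_mod_cast Fintype.card_pos
  have hw : ∀ w : Fin J → ι, μ {ω | (fun j => v j ω) = w}
      = ENNReal.ofReal ((1 / (Fintype.card ι : ℝ)) ^ J) := by
    intro w
    have e : {ω | (fun j => v j ω) = w} = ⋂ j ∈ Finset.univ, v j ⁻¹' {w j} := by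
      ext ω
      simp [funext_iff]
    rw [e, hv.indep.measure_inter_preimage_eq_mul Finset.univ
      fun j _ => measurableSet_singleton (w j)]
    have : ∀ j, μ (v j ⁻¹' {w j}) = ENNReal.ofReal (1 / (Fintype.card ι : ℝ)) := fun j =>
      hv.prob j (w j)
    rw [ENNReal.ofReal_pow (by positivity)]
    simp [this]
  have e : {ω | (fun j => v j ω) ∈ F} = ⋃ w ∈ F, {ω | (fun j => v j ω) = w} := by
    ext ω
    simp
  rw [e]
  refine (measure_biUnion_finset_le _ _).trans ?_
  simp only [hw, Finset.sum_const, nsmul_eq_mul]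
  rw [← ENNReal.ofReal_natCast, ← ENNReal.ofReal_mul (Nat.cast_nonneg _)]
  refine ENNReal.ofReal_le_ofReal ?_
  rw [one_div, inv_pow, ← div_eq_mul_inv, div_le_iff₀ (by positivity)]
  linarith

/-- Conditioning on an independent variable with finitely many values. -/
lemma measure_mem_of_indepFun_le {S V : Type*} [MeasurableSpace S] [MeasurableSingletonClass S]
    [MeasurableSpace V] [IsProbabilityMeasure μ] {A : Ω → S} {B : Ω → V} (hA : Measurable A)
    (hAB : IndepFun A B μ) (T : Finset S) (F : S → Set V) (hFm : ∀ τ, MeasurableSet (F τ))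
    {η : ENNReal} (hF : ∀ τ ∈ T, μ (B ⁻¹' F τ) ≤ η) :
    μ {ω | A ω ∈ T ∧ B ω ∈ F (A ω)} ≤ η := by
  have hsub : {ω | A ω ∈ T ∧ B ω ∈ F (A ω)} ⊆ ⋃ τ ∈ T, A ⁻¹' {τ} ∩ B ⁻¹' F τ := by
    intro ω hω
    simp only [Set.mem_iUnion]
    exact ⟨A ω, hω.1, rfl, hω.2⟩
  calc _ ≤ ∑ τ ∈ T, μ (A ⁻¹' {τ} ∩ B ⁻¹' F τ) :=
        (measure_mono hsub).trans (measure_biUnion_finset_le _ _)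
    _ = ∑ τ ∈ T, μ (A ⁻¹' {τ}) * μ (B ⁻¹' F τ) := Finset.sum_congr rfl fun τ _ =>
        hAB.measure_inter_preimage_eq_mul _ _ (measurableSet_singleton τ) (hFm τ)
    _ ≤ ∑ τ ∈ T, μ (A ⁻¹' {τ}) * η := by
        gcongr with τ hτ
        exact hF τ hτ
    _ = μ (⋃ τ ∈ T, A ⁻¹' {τ}) * η := by
        rw [← Finset.sum_mul, measure_biUnion_finset]
        · intro τ _ τ' _ hne
          exact Disjoint.preimage A (by simpa using hne)
        · exact fun τ _ => hA (measurableSet_singleton τ)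
    _ ≤ 1 * η := by gcongr; exact prob_le_one
    _ = η := one_mul η

end Samples

/-! ### Sampling from a coherent Kronecker transform -/

/-- The exponent of the Bernstein bound; this is where the constant `8 / 3` enters. -/
lemma le_bernstein_exponent {M R ε L J : ℝ} (hM : 0 < M) (hR : 1 ≤ R) (hε0 : 0 < ε)
    (hε1 : ε < 1) (hL : 0 ≤ L) (hJ : 8 / 3 * (R * M) * (ε ^ 2)⁻¹ * L ≤ J) :
    L ≤ J * ε ^ 2 / (2 * (M * R + M * ε / 3)) := by
  rw [le_div_iff₀ (by positivity)]
  have h1 : 8 / 3 * (R * M) * L ≤ J * ε ^ 2 := by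
    have := mul_le_mul_of_nonneg_right hJ (sq_nonneg ε)
    have e : 8 / 3 * (R * M) * (ε ^ 2)⁻¹ * L * ε ^ 2 = 8 / 3 * (R * M) * L := by field_simp
    linarith
  have h2 : 0 ≤ M * L * (R - ε) := mul_nonneg (mul_nonneg hM.le hL) (by linarith)
  nlinarith

/-- If for a fixed choice of signs all entries of the transformed bases `b p` are small, most
samples of rows embed the column space with the orthonormal basis `e`. -/
lemma card_bad_samples_kronHadamard_le {P R J : ℕ} {k : Fin P → ℕ} (hR : 0 < R)
    (x : Fin R → ∀ p, Fin (2 ^ k p) → ℝ) {s : ∀ p, Fin (2 ^ k p) → ℝ}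
    (hs : ∀ p j, s p j ^ 2 = 1)
    {d : Fin P → ℕ} (hd : ∀ p, d p ≤ R) (b : ∀ p, Fin (d p) → Fin (2 ^ k p) → ℝ)
    (hb : ∀ p a a', ∑ j, b p a j * b p a' j = if a = a' then 1 else 0)
    (hbx : ∀ r p, x r p = ∑ a, (∑ j, b p a j * x r p j) • b p a)
    {D : ℕ} (hD : D ≤ R) (e : Fin D → (∀ p, Fin (2 ^ k p)) → ℝ)
    (he : ∀ a a', ∑ j, e a j * e a' j = if a = a' then 1 else 0)
    (hex : ∀ a, ∃ c : Fin R → ℝ, e a = ∑ r, c r • kronVec (x r))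
    {L : Fin P → ℝ} (hL : ∀ p, 0 < L p)
    (hcoh : ∀ p i a, ((hadamard (k p) * Matrix.diagonal (s p)).mulVec (b p a) i) ^ 2
      ≤ 2 * L p / 2 ^ k p)
    {ε L₀ : ℝ} (hε0 : 0 < ε) (hε1 : ε < 1) (hL₀ : 0 ≤ L₀)
    (hJ : 8 / 3 * (R * ∏ p, (R * (2 * L p))) * (ε ^ 2)⁻¹ * L₀ ≤ J)
    [DecidablePred fun v : Fin J → ∀ p, Fin (2 ^ k p) => ∃ c : Fin D → ℝ,
      J * ε * ∑ a, c a ^ 2 < |Fintype.card (∀ p, Fin (2 ^ k p)) *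
        ∑ j, (∑ a, c a * (kronHadamard k s).mulVec (e a) (v j)) ^ 2 - J * ∑ a, c a ^ 2|] :
    ((Finset.univ.filter fun v : Fin J → ∀ p, Fin (2 ^ k p) => ∃ c : Fin D → ℝ,
      J * ε * ∑ a, c a ^ 2 < |Fintype.card (∀ p, Fin (2 ^ k p)) *
        ∑ j, (∑ a, c a * (kronHadamard k s).mulVec (e a) (v j)) ^ 2
          - J * ∑ a, c a ^ 2|).card : ℝ)
      ≤ (Fintype.card (∀ p, Fin (2 ^ k p)) : ℝ) ^ J * (2 * Real.exp (-L₀)) := by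
  have hR' : (0 : ℝ) < R := by exact_mod_cast hR
  have hM0 : 0 < ∏ p, (R * (2 * L p)) := Finset.prod_pos fun p _ =>
    mul_pos hR' (mul_pos two_pos (hL p))
  have hN : (Fintype.card (∀ p, Fin (2 ^ k p)) : ℝ) = ∏ p, 2 ^ k p := by
    simp
  have hlev : ∀ i, Fintype.card (∀ p, Fin (2 ^ k p)) *
      ∑ a, ((kronHadamard k s).mulVec (e a) i) ^ 2 ≤ ∏ p, (R * (2 * L p)) := by
    intro i
    calc _ ≤ (∏ p, (2 : ℝ) ^ k p) * ∏ p, (R * (2 * L p / 2 ^ k p)) := by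
          rw [hN]
          gcongr
          refine (leverage_kron_le _ i x b hb hbx e he hex).trans ?_
          refine Finset.prod_le_prod (fun p _ => Finset.sum_nonneg fun a _ => sq_nonneg _)
            fun p _ => (Finset.sum_le_sum fun a _ => hcoh p (i p) a).trans ?_
          have hdR : (d p : ℝ) ≤ R := by exact_mod_cast hd p
          have := hL p
          simp only [Finset.sum_const, Finset.card_univ, Fintype.card_fin, nsmul_eq_mul]
          gcongr
      _ = _ := by
          rw [← Finset.prod_mul_distrib]
          refine Finset.prod_congr rfl fun p _ => ?_
          field_simp
  refine (card_bad_samples_le (U := fun i a => (kronHadamard k s).mulVec (e a) i)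
    (fun a a' => ?_) hR (by simpa using hD) hM0 hlev hε0 J).trans ?_
  · rw [sum_mulVec_mul_mulVec (kronHadamard_orthonormal k hs)]
    exact he a a'
  · gcongr
    exact le_bernstein_exponent hM0 (by exact_mod_cast hR) hε0 hε1 hL₀ hJ

end KFJLT

theorem theorem2 {Ω : Type*} [MeasurableSpace Ω] (μ : Measure Ω) [IsProbabilityMeasure μ]
    (P R J : ℕ) (k : Fin P → ℕ)
    (X : Matrix (∀ p, Fin (2 ^ k p)) (Fin R) ℝ)
    (hX : ∀ r, (fun i => X i r) ∈ KFJLT.kronVectors (fun p => Fin (2 ^ k p)))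
    -- the random diagonals of the matrices `D`, and the sampled row indices
    (s : ∀ p, Fin (2 ^ k p) → Ω → ℝ)
    (v : Fin J → Ω → ∀ p, Fin (2 ^ k p))
    (hs : ∀ p i, KFJLT.IsRademacher (s p i) μ)
    (hs_indep : iIndepFun (fun a : (Σ p, Fin (2 ^ k p)) => s a.1 a.2) μ)
    (hv : KFJLT.IsSampleVector (KFJLT.uniformDist (∀ p, Fin (2 ^ k p))) v μ)
    (hsv : IndepFun (fun ω (a : Σ p, Fin (2 ^ k p)) => s a.1 a.2 ω) (fun ω j => v j ω) μ)
    (ε δ : ℝ) (hε0 : 0 < ε) (hε1 : ε < 1) (hδ : 0 < δ)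
    (hJ : (8 / 3 : ℝ) * 2 ^ P * (R : ℝ) ^ (P + 1) * (ε ^ 2)⁻¹
        * Real.log (2 * (R : ℝ) * ((P : ℝ) + 1) / δ)
        * ∏ p, Real.log (2 * ((2 ^ k p : ℕ) : ℝ) * (R : ℝ) * ((P : ℝ) + 1) / δ) < (J : ℝ)) :
    ENNReal.ofReal (1 - δ) ≤
      μ {ω | KFJLT.IsSubspaceEmbedding ε
        (KFJLT.samplingMatrix (KFJLT.uniformDist (∀ p, Fin (2 ^ k p))) (fun j => v j ω)
          * KFJLT.kronHadamard k (fun p i => s p i ω)) X} := by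
  classical
  rcases le_or_gt 1 δ with hδ1 | hδ1
  · rw [ENNReal.ofReal_of_nonpos (by linarith)]
    exact zero_le
  rcases Nat.eq_zero_or_pos R with rfl | hR
  · have hzero : ∀ z, X.mulVec z = 0 := fun z => by
      ext i
      simp [Matrix.mulVec, dotProduct]
    simp only [KFJLT.IsSubspaceEmbedding, hzero, Matrix.mulVec_zero, WithLp.toLp_zero, norm_zero]
    simp [hδ.le]
  have hR1 : (1 : ℝ) ≤ R := by exact_mod_cast hR
  have hP1 : (1 : ℝ) ≤ (P : ℝ) + 1 := by linarith [(Nat.cast_nonneg P : (0 : ℝ) ≤ P)]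
  set L₀ := Real.log (2 * (R : ℝ) * ((P : ℝ) + 1) / δ) with hL₀
  set L : Fin P → ℝ := fun p =>
    Real.log (2 * ((2 ^ k p : ℕ) : ℝ) * (R : ℝ) * ((P : ℝ) + 1) / δ) with hLdef
  have hRP : 1 ≤ (R : ℝ) * ((P : ℝ) + 1) := one_le_mul_of_one_le_of_one_le hR1 hP1
  have hL₀0 : 0 < L₀ := by
    refine Real.log_pos ?_
    rw [one_lt_div hδ]
    nlinarith
  have hL0 : ∀ p, 0 < L p := by
    intro p
    have h2 : (1 : ℝ) ≤ ((2 ^ k p : ℕ) : ℝ) := by exact_mod_cast Nat.one_le_two_pow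
    refine Real.log_pos ?_
    rw [one_lt_div hδ]
    nlinarith [one_le_mul_of_one_le_of_one_le h2 hRP]
  have hJM : 8 / 3 * (R * ∏ p, (R * (2 * L p))) * (ε ^ 2)⁻¹ * L₀ < J := by
    refine lt_of_eq_of_lt ?_ hJ
    rw [Finset.prod_mul_distrib, Finset.prod_mul_distrib]
    simp only [Finset.prod_const, Finset.card_univ, Fintype.card_fin]
    ring
  have hJ0 : 0 < J := by
    have hM : 0 < ∏ p, (R * (2 * L p)) := Finset.prod_pos fun p _ =>
      mul_pos (by linarith) (mul_pos two_pos (hL0 p))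
    have : (0 : ℝ) < J := lt_of_le_of_lt (by positivity) hJM
    exact_mod_cast this
  -- the factors of the columns, and orthonormal bases of the spans of the factors and the columns
  choose x hx using hX
  choose d hd b hb _ hbx using fun p => KFJLT.exists_orthonormal_coords fun r => x r p
  obtain ⟨D, hD, e, he, hex, hez⟩ :=
    KFJLT.exists_orthonormal_coords fun r => KFJLT.kronVec (x r)
  have hbx' : ∀ r p, x r p = ∑ a, (∑ j, b p a j * x r p j) • b p a := by
    intro r p
    have h := hbx p (Pi.single r 1)
    have hr : ∑ r', (Pi.single r 1 : Fin R → ℝ) r' • x r' p = x r p := by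
      simp [Pi.single_apply]
    rwa [hr] at h
  have hspan : ∀ z, ∃ c : Fin D → ℝ, X.mulVec z = ∑ a, c a • e a := by
    intro z
    refine ⟨_, Eq.trans ?_ (hez z)⟩
    ext i
    simp only [Matrix.mulVec, dotProduct, hx, Finset.sum_apply, Pi.smul_apply, smul_eq_mul]
    exact Finset.sum_congr rfl fun r _ => by rw [← congrFun (hx r) i, mul_comm]
  let A : Ω → (Σ p, Fin (2 ^ k p)) → ℝ := fun ω a => s a.1 a.2 ω
  -- the samples that fail to embed the column space under the sign pattern `τ`
  let bad : ((Σ p, Fin (2 ^ k p)) → ℝ) → Finset (Fin J → ∀ p, Fin (2 ^ k p)) := fun τ =>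
    Finset.univ.filter fun w => ∃ c : Fin D → ℝ,
      J * ε * ∑ a, c a ^ 2 < |Fintype.card (∀ p, Fin (2 ^ k p)) *
        ∑ j, (∑ a, c a * (KFJLT.kronHadamard k fun p i => τ ⟨p, i⟩).mulVec (e a) (w j)) ^ 2
          - J * ∑ a, c a ^ 2|
  let T : Finset ((Σ p, Fin (2 ^ k p)) → ℝ) :=
    (Fintype.piFinset fun _ => {1, -1}).filter fun τ => ∀ p i a,
      ((KFJLT.hadamard (k p) * Matrix.diagonal fun j => τ ⟨p, j⟩).mulVec (b p a) i) ^ 2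
        ≤ 2 * L p / 2 ^ k p
  -- the null event that a value is not a sign, the events that an entry of the `p`-th transformed
  -- basis is large, and the event that the signs are good but the sample is bad for them
  let E₁ : Set Ω := {ω | ¬ ∀ a : (Σ p, Fin (2 ^ k p)), s a.1 a.2 ω = 1 ∨ s a.1 a.2 ω = -1}
  let E₂ : Fin P → Set Ω := fun p => {ω | ∃ i a, 2 * L p / 2 ^ k p
    ≤ ((KFJLT.hadamard (k p) * Matrix.diagonal fun j => s p j ω).mulVec (b p a) i) ^ 2}
  let E₃ : Set Ω := {ω | A ω ∈ T ∧ (fun j => v j ω) ∈ (bad (A ω) : Set _)}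
  have h₁ : μ E₁ = 0 := by
    have : ∀ᵐ ω ∂μ, ∀ a : (Σ p, Fin (2 ^ k p)), s a.1 a.2 ω = 1 ∨ s a.1 a.2 ω = -1 :=
      ae_all_iff.2 fun a => (hs a.1 a.2).ae_eq_or
    exact ae_iff.1 this
  have h₂ : ∀ p, μ (E₂ p) ≤ ENNReal.ofReal (δ / (P + 1)) := by
    intro p
    have hind : iIndepFun (s p) μ :=
      hs_indep.precomp (g := fun j => (⟨p, j⟩ : Σ p, Fin (2 ^ k p)))
        fun j j' h => by simpa using h
    have h := KFJLT.measure_exists_hadamard_entry_ge_le (hs p) hind (b p)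
      (fun a => by simpa using hb p a a) (hL0 p).le
    rw [← ofReal_measureReal]
    refine ENNReal.ofReal_le_ofReal (h.trans ?_)
    have hdR : (d p : ℝ) ≤ R := by exact_mod_cast hd p
    rw [Real.exp_neg, hLdef, Real.exp_log (by positivity)]
    calc _ ≤ (2 : ℝ) ^ k p * R
          * (2 * (2 * ((2 ^ k p : ℕ) : ℝ) * (R : ℝ) * ((P : ℝ) + 1) / δ)⁻¹) := by gcongr
      _ = δ / (P + 1) := by push_cast; field_simp
  have h₃ : μ E₃ ≤ ENNReal.ofReal (δ / (P + 1)) := by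
    refine KFJLT.measure_mem_of_indepFun_le (measurable_pi_lambda _ fun a => (hs a.1 a.2).measurable)
      hsv T (fun τ => (bad τ : Set _)) (fun τ => (Set.toFinite _).measurableSet) fun τ hτ => ?_
    obtain ⟨hτ1, hτ2⟩ := Finset.mem_filter.1 hτ
    refine hv.measure_mem_le (bad τ) ((KFJLT.card_bad_samples_kronHadamard_le hR x ?_ hd b hb hbx'
      hD e he hex hL0 hτ2 hε0 hε1 hL₀0.le hJM.le).trans ?_)
    · intro p j
      have := Fintype.mem_piFinset.1 hτ1 ⟨p, j⟩
      simp only [Finset.mem_insert, Finset.mem_singleton] at this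
      rcases this with h | h <;> simp [h]
    · gcongr
      rw [Real.exp_neg, hL₀, Real.exp_log (by positivity)]
      calc 2 * (2 * (R : ℝ) * (P + 1) / δ)⁻¹ = δ / (P + 1) / R := by field_simp
        _ ≤ δ / (P + 1) := div_le_self (by positivity) hR1
  set G := {ω | KFJLT.IsSubspaceEmbedding ε
        (KFJLT.samplingMatrix (KFJLT.uniformDist (∀ p, Fin (2 ^ k p))) (fun j => v j ω)
          * KFJLT.kronHadamard k (fun p i => s p i ω)) X} with hG
  have hcover : (Set.univ : Set Ω) ⊆ G ∪ (E₁ ∪ ((⋃ p, E₂ p) ∪ E₃)) := by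
    intro ω _
    by_contra hω
    simp only [Set.mem_union, Set.mem_iUnion, not_or, not_exists] at hω
    obtain ⟨hωG, hω₁, hω₂, hω₃⟩ := hω
    refine hωG (KFJLT.isSubspaceEmbedding_of_forall hJ0 _ X _ e he hspan ?_)
    by_contra! hc
    refine hω₃ ⟨Finset.mem_filter.2 ⟨?_, fun p i a => ?_⟩, ?_⟩
    · have := not_not.1 hω₁
      simpa [A, Fintype.mem_piFinset] using this
    · exact (not_le.1 fun h => hω₂ p ⟨i, a, h⟩).le
    · exact Finset.mem_coe.2 (Finset.mem_filter.2 ⟨Finset.mem_univ _, hc⟩)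
  have hbad : μ (E₁ ∪ ((⋃ p, E₂ p) ∪ E₃)) ≤ ENNReal.ofReal δ := by
    calc _ ≤ μ E₁ + (∑ p, μ (E₂ p) + μ E₃) := (measure_union_le _ _).trans (by
            gcongr
            exact (measure_union_le _ _).trans (by gcongr; exact measure_iUnion_fintype_le _ _))
      _ ≤ 0 + (∑ _p : Fin P, ENNReal.ofReal (δ / (P + 1)) + ENNReal.ofReal (δ / (P + 1))) := by
            rw [h₁]
            gcongr with p
            exact h₂ p
      _ = ENNReal.ofReal δ := by
            rw [← ENNReal.ofReal_sum_of_nonneg fun _ _ => by positivity,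
              ← ENNReal.ofReal_add (Finset.sum_nonneg fun _ _ => by positivity) (by positivity),
              zero_add]
            congr 1
            simp only [Finset.sum_const, Finset.card_univ, Fintype.card_fin, nsmul_eq_mul]
            field_simp
  rw [ENNReal.ofReal_sub _ hδ.le, ENNReal.ofReal_one, tsub_le_iff_right, ← measure_univ (μ := μ)]
  exact (measure_mono hcover).trans ((measure_union_le _ _).trans (by gcongr))
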